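/- Let $\mathcal C=\{0,1\}^{\mathbb N}$ be Cantor space and let $\mathcal P$ be the set of Borel probability measures (*sources*) on $\mathcal C$. For a binary string $w$ let $B_w$ be the set of sequences that begin with $w$, and write $\nu(w)=\nu(B_w)$ and $\nu(s\mid w)=\nu(ws)/\nu(w)$ for $\nu\in\mathcal P$ and $s\in\{0,1\}$; $\sigma[n]$ is the string of the first $n$ bits of $\sigma\in\mathcal C$. A source $\nu$ is *computable* if there is a computable $F:\{0,1\}^*\times\mathbb N\to\mathbb Q$ with $|\nu(w)-F(w,n)|<2^{-n}$ for all $w$ and $n$; $\mathfrak P$ is the set of computable sources. A *forecaster* is a source of full support. A forecaster $\mu$ *weakly NC-learns* a source $\lambda$ if for $\lambda$-almost every $\sigma$ there is a set $K\subseteq\mathbb N$ of asymptotic density one with $$\lim_{n\to\infty,\ n\in K}\bigl(\mu(s\mid\sigma[n])-\lambda(s\mid\sigma[n])\bigr)=0\qquad(s=0,1),$$ and $\mathcal{NC}^w(\mu)$ is the set of computable sources that $\mu$ weakly NC-learns. For $k\in\mathbb N$ let $\mathcal P_k$ be the set of probability measures on $\{0,1\}^k$ with the metric $d(m,m')=\max_{w\in\{0,1\}^k}|m(w)-m'(w)|$,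 and let $\Pi_k:\mathcal P\to\mathcal P_k$ be the restriction map, $\Pi_k(\nu)(w)=\nu(w)$. Let $\mathcal W$ be the countable basis of $\mathcal P$ that consists of the sets $\Pi_k^{-1}(\{m' : d(m,m')<\varepsilon\})$ with $k\in\mathbb N$, $m\in\mathcal P_k$ rational-valued and $\varepsilon>0$ rational. Its elements are coded in the evident way by the finite data $(k,m,\varepsilon)$. A function $F:\mathbb N\times\mathcal W\to\mathcal W$ is *computable* if some computable function sends every pair ($n$, code of $W$) to a code of $F(n,W)$. A set $A\subseteq\mathfrak P$ is *effectively meagre* if there are a computable $F:\mathbb N\times\mathcal W\to\mathcal W$ and sets $A_n\subseteq\mathfrak P$ ($n\in\mathbb N$) such that $A=\bigcup_n A_n$ and, for all $n\in\mathbb N$ and $W\in\mathcal W$, $F(n,W)\subseteq W$ and $A_n\cap F(n,W)=\varnothing$. **Proposition.** For every computable forecaster $\mu$, the set $\mathcal{NC}^w(\mu)$ is an effectively meagre subset of $\mathfrak P$. -/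

import Mathlib

open MeasureTheory Filter Topology

noncomputable section

/-- Cantor space; the bits of a sequence are indexed from `0`. -/
abbrev Cantor : Type := ℕ → Bool

/-- The space `𝒫` of sources: Borel probability measures on Cantor space. -/
abbrev Source : Type := ProbabilityMeasure Cantor

namespace Forecast

/-- `σ[n]`: the string formed by the first `n` bits of `σ`. -/
def initSeg (σ : Cantor) (n : ℕ) : List Bool := List.ofFn fun i : Fin n => σ i

/-- The basic open set `B_w` of all sequences that begin with the string `w`. -/
def cyl (w : List Bool) : Set Cantor := {σ | initSeg σ w.length = w}

/-- `ν(w)`, the probability that the source `ν` gives to `B_w`. -/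
def mass (ν : Source) (w : List Bool) : ℝ := (ν : Measure Cantor).real (cyl w)

/-- `ν(s | w)`, the conditional probability of next bit `s` after `w` (used only where
`ν(w) > 0`, which holds along `ν`-almost every sequence). -/
def condProb (ν : Source) (s : Bool) (w : List Bool) : ℝ := mass ν (w ++ [s]) / mass ν w

/-- A rational-valued function is computable if its numerator and denominator are. -/
def ComputableRat {α : Type*} [Primcodable α] (F : α → ℚ) : Prop :=
  Computable (fun x => (F x).num) ∧ Computable (fun x => (F x).den)

/-- Computability of a source: the values `ν(w)` can be computed to within `2⁻ⁿ`, uniformly. -/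
def IsComputableSource (ν : Source) : Prop :=
  ∃ F : List Bool × ℕ → ℚ, ComputableRat F ∧
    ∀ (w : List Bool) (n : ℕ), |mass ν w - (F (w, n) : ℝ)| < (2 : ℝ)⁻¹ ^ n

/-- The set `𝔓` of computable sources. -/
def computableSources : Set Source := {ν | IsComputableSource ν}

/-- A forecaster is a Borel probability measure on Cantor space of full support. -/
def IsForecaster (μ : Source) : Prop := (μ : Measure Cantor).IsOpenPosMeasure

/-- Asymptotic density one. -/
def HasDensityOne (K : Set ℕ) : Prop :=
  Tendsto (fun n : ℕ => ((K ∩ Set.Iio n).ncard : ℝ) / n) atTop (𝓝 1)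

/-- `μ` weakly NC-learns `ν`. -/
def WeaklyNCLearns (μ ν : Source) : Prop :=
  ∀ᵐ σ ∂(ν : Measure Cantor), ∃ K : Set ℕ, HasDensityOne K ∧
    ∀ s : Bool, Tendsto (fun n : ℕ => condProb μ s (initSeg σ n) - condProb ν s (initSeg σ n))
      (atTop ⊓ 𝓟 K) (𝓝 0)

/-- The set of computable sources that are weakly NC-learned by `μ`. -/
def NCw (μ : Source) : Set Source := {ν | ν ∈ computableSources ∧ WeaklyNCLearns μ ν}

/-- `𝒫_k`: probability measures on the set of `k`-bit strings, as vectors of `2^k` weights.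
Its metric is the sup metric `max_w |μ(w) - ν(w)|`. -/
abbrev Level (k : ℕ) : Type := stdSimplex ℝ (Fin k → Bool)

theorem cyl_ofFn {k : ℕ} (w : Fin k → Bool) :
    cyl (List.ofFn w) = (fun (σ : Cantor) (i : Fin k) => σ i) ⁻¹' {w} := by
  ext σ
  simp only [cyl, initSeg, Set.mem_ofPred_eq, Set.mem_preimage, Set.mem_singleton_iff]
  constructor
  · intro h
    funext i
    have := congrArg (fun l : List Bool => l[(i : ℕ)]?) h
    simpa using this
  · intro h
    subst h
    apply List.ext_getElem <;> simp

/-- The restriction map `Π_k : 𝒫 → 𝒫_k`. -/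
def restrict (k : ℕ) (ν : Source) : Level k :=
  ⟨fun w => mass ν (List.ofFn w), fun _ => measureReal_nonneg, by
    have hm : Measurable (fun (σ : Cantor) (i : Fin k) => σ i) :=
      measurable_pi_lambda _ fun i => measurable_pi_apply _
    have h := sum_measureReal_preimage_singleton (μ := (ν : Measure Cantor))
      (f := fun (σ : Cantor) (i : Fin k) => σ i) Finset.univ
      (fun y _ => hm (measurableSet_singleton y))
    simp only [mass, cyl_ofFn]
    rw [h]
    simp⟩

/-- The basis `𝒲`: preimages under the maps `Π_k` of rational open balls of the `𝒫_k`. -/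
def basisW : Set (Set Source) :=
  {W | ∃ (k : ℕ) (m : Level k) (ε : ℚ), (∀ w, ∃ q : ℚ, m.1 w = q) ∧ 0 < ε ∧
    W = restrict k ⁻¹' Metric.ball m (ε : ℝ)}

/-- Codes of elements of `𝒲`: a level `k`, a list of `2^k` natural numbers (the numerators of the
values of a rational-valued measure over a common denominator, their sum), and the numerator
and the denominator of the radius. -/
abbrev Code : Type := ℕ × List ℕ × ℕ × ℕ

/-- `c` is a code of the set `W`. The `k`-bit string `w` owns the entry of the list whose index
is the number with binary digits `w`, least significant bit first. -/
def IsCode : Code → Set Source → Prop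
  | (k, a, p, q), W => a.length = 2 ^ k ∧ 0 < p ∧ 0 < q ∧
      ∃ m : Level k, (∀ w, m.1 w = (a.getD (Nat.ofBits w) 0 : ℝ) / (a.sum : ℝ)) ∧
        W = restrict k ⁻¹' Metric.ball m ((p : ℝ) / (q : ℝ))

/-- A function `F : ℕ × 𝒲 → 𝒲` is computable if some computable function sends each number `n`
and each code of `W` to a code of `F(n, W)`. -/
def ComputableOnW (F : ℕ → basisW → basisW) : Prop :=
  ∃ g : ℕ × Code → Code, Computable g ∧
    ∀ (n : ℕ) (c : Code) (W : basisW), IsCode c W.1 → IsCode (g (n, c)) (F n W).1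

/-- The two conditions for `A` to be nowhere dense via `f : 𝒲 → 𝒲`. -/
def NowhereDenseVia (A : Set Source) (f : basisW → basisW) : Prop :=
  ∀ W : basisW, (f W).1 ⊆ W.1 ∧ A ∩ (f W).1 = ∅

/-- `A` is an effectively meagre subset of the set `𝔓` of computable sources. -/
def EffectivelyMeagre (A : Set Source) : Prop :=
  A ⊆ computableSources ∧
    ∃ F : ℕ → basisW → basisW, ComputableOnW F ∧
      ∃ B : ℕ → Set Source, (∀ n, B n ⊆ computableSources) ∧
        (∀ n, NowhereDenseVia (B n) (F n)) ∧ A = ⋃ n, B n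

/-- Only elements of `𝒲` have codes. -/
theorem IsCode.mem_basisW {c : Code} {W : Set Source} (h : IsCode c W) : W ∈ basisW := by
  obtain ⟨k, a, p, q⟩ := c
  obtain ⟨-, hp, hq, m, hm, rfl⟩ := h
  refine ⟨k, m, (p : ℚ) / q, fun w => ⟨(a.getD (Nat.ofBits w) 0 : ℚ) / (a.sum : ℚ), ?_⟩, ?_, ?_⟩
  · rw [hm, Rat.cast_div, Rat.cast_natCast, Rat.cast_natCast]
  · positivity
  · rw [Rat.cast_div, Rat.cast_natCast, Rat.cast_natCast]

/-- Each element of `𝒲` has a code. -/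
theorem exists_isCode {W : Set Source} (hW : W ∈ basisW) : ∃ c, IsCode c W := by
  obtain ⟨k, m, ε, hm, hε, rfl⟩ := hW
  choose r hr using hm
  have hr0 : ∀ w, 0 ≤ r w := fun w => by
    have h := m.2.1 w
    rw [hr w] at h
    exact_mod_cast h
  have hr1 : ∑ w, r w = 1 := by
    have h := m.2.2
    rw [Finset.sum_congr rfl fun w _ => hr w] at h
    exact_mod_cast h
  set D : ℕ := ∏ w, (r w).den with hD
  have hDpos : 0 < D := Finset.prod_pos fun w _ => (r w).den_pos
  have hnum : ∀ w, ∃ n : ℕ, (n : ℚ) = r w * D := fun w => by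
    obtain ⟨e, he⟩ : (r w).den ∣ D := Finset.dvd_prod_of_mem _ (Finset.mem_univ w)
    refine ⟨(r w).num.toNat * e, ?_⟩
    have h1 : (((r w).num.toNat : ℤ) : ℚ) = ((r w).num : ℚ) := by
      rw [Int.toNat_of_nonneg (Rat.num_nonneg.2 (hr0 w))]
    have h2 : r w * (r w).den = (r w).num := Rat.mul_den_eq_num (r w)
    rw [he]
    push_cast at h1 ⊢
    rw [h1, ← mul_assoc, h2]
  choose N hN using hnum
  have hNsum : ∑ w, N w = D := by
    have h : ((∑ w, N w : ℕ) : ℚ) = D := by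
      push_cast
      rw [Finset.sum_congr rfl fun w _ => hN w, ← Finset.sum_mul, hr1, one_mul]
    exact_mod_cast h
  let a : List ℕ := (List.range (2 ^ k)).map fun i => N fun j : Fin k => i.testBit j
  have hget : ∀ w : Fin k → Bool, a.getD (Nat.ofBits w) 0 = N w := fun w => by
    have hlt := Nat.ofBits_lt_two_pow w
    simp [a, List.getD, hlt]
  have hsum : a.sum = D := by
    rw [← hNsum]
    have h : a.sum = ∑ i ∈ Finset.range (2 ^ k), N fun j : Fin k => i.testBit j := by
      rw [Finset.sum_range, ← List.sum_ofFn]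
      congr 1
      apply List.ext_getElem <;> simp [a]
    rw [h]
    refine Finset.sum_bij' (fun i _ => fun j : Fin k => i.testBit j) (fun w _ => Nat.ofBits w)
      (fun _ _ => Finset.mem_univ _)
      (fun w _ => Finset.mem_range.2 (Nat.ofBits_lt_two_pow w)) ?_ ?_ (fun _ _ => rfl)
    · intro i hi
      simp only [Nat.ofBits_testBit]
      exact Nat.mod_eq_of_lt (Finset.mem_range.1 hi)
    · intro w _
      funext j
      exact Nat.testBit_ofBits_lt w j j.2
  refine ⟨(k, a, ε.num.toNat, ε.den), by simp [a], ?_, ε.den_pos, m, fun w => ?_, ?_⟩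
  · have := Rat.num_pos.2 hε
    omega
  · have hD0 : (D : ℝ) ≠ 0 := by exact_mod_cast hDpos.ne'
    have h : (N w : ℝ) = (r w : ℝ) * D := by exact_mod_cast hN w
    rw [hget, hsum, hr w, h, mul_div_cancel_right₀ _ hD0]
  · have h1 : ((ε.num.toNat : ℤ) : ℝ) = (ε.num : ℝ) := by
      rw [Int.toNat_of_nonneg (Rat.num_pos.2 hε).le]
    have h2 : ((ε.num.toNat : ℕ) : ℝ) / (ε.den : ℝ) = (ε : ℝ) := by
      push_cast at h1
      rw [h1, Rat.cast_def]
    rw [h2]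

end Forecast

end

/-! After every string one of the two bits has conditional `μ`-probability at most 1/2, so a bit `b
w` of conditional probability below 5/8 can be computed from `w`; full support makes the search halt
(`exists_computable_unlikely_bit`). A source that follows `b` almost surely after `w` is there more
than 1/4 away from the forecast of `μ`.

A basic open set `W` leaves the distant future free. So `W` contains a small ball of sources that
are almost unconstrained in no way before some level `n` beyond approximate weights, and then follow
`b` closely up to level `M = 2 * n + N`. For a source in this ball, outside an event of probability
at most 1/2, forecast and truth agree to within 1/4 only at positions below `n`, hence at no more
than half of the first `M` positions (`measure_agreement_le`). Conversely, if `μ` weakly learns `ν`,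
then for some `N` and all `M ≥ N` there is agreement at more than half of the first `M` positions
with probability above 1/2 (`WeaklyNCLearns.exists_lt_measure_agreement`). The sources with a given
`N` form the `N`-th nowhere dense piece.

The function on basic sets must depend on `W` and not on its code, although one set has many codes.
The construction therefore starts from the first `x`, a level with natural weights, that satisfies
`Admissible x W`: a property of the set alone, which any code of the set makes decidable
(`exists_computable_admissible`). -/

namespace Forecast

/-! ### Computable operations on numbers, lists and predicates. -/

section Computability

variable {α β σ : Type*} [Primcodable α] [Primcodable β] [Primcodable σ]

theorem computable_nat_find {p : α → ℕ → Bool} (hp : Computable₂ p) (h : ∀ a, ∃ n, p a n = true) :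
    Computable fun a => Nat.find (h a) := by
  have h1 : Partrec fun a => Nat.rfind (fun n => (Part.some (p a n) : Part Bool)) :=
    Partrec.rfind (p := fun a n => Part.some (p a n)) hp.partrec₂
  refine Partrec.of_eq_tot h1 fun a => ?_
  refine Nat.mem_rfind.2 ⟨by simpa using (Nat.find_spec (h a)).symm, fun {m} hm => ?_⟩
  simpa using Nat.find_min (h a) hm

theorem computable_map_range {f : α → ℕ} {g : α → ℕ → σ} (hf : Computable f)
    (hg : Computable₂ g) : Computable fun a => (List.range (f a)).map (g a) := by
  have h : Computable fun a => Nat.rec (motive := fun _ => List σ) []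
      (fun n l => l ++ [g a n]) (f a) :=
    Computable.nat_rec (h := fun a (p : ℕ × List σ) => p.2 ++ [g a p.1]) hf (Computable.const [])
      (Computable.list_append.comp (Computable.snd.comp Computable.snd)
        (Computable.list_cons.comp
          (hg.comp Computable.fst (Computable.fst.comp Computable.snd)) (Computable.const [])))
  refine h.of_eq fun a => ?_
  induction f a with
  | zero => rfl
  | succ n ih => simp [List.range_succ, ← ih]

theorem computable_nat_add {f g : α → ℕ} (hf : Computable f) (hg : Computable g) :
    Computable fun a => f a + g a := Primrec.nat_add.to_comp.comp hf hg

theorem computable_nat_mul {f g : α → ℕ} (hf : Computable f) (hg : Computable g) :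
    Computable fun a => f a * g a := Primrec.nat_mul.to_comp.comp hf hg

theorem primrec_nat_pow : Primrec₂ ((· ^ ·) : ℕ → ℕ → ℕ) :=
  Primrec₂.unpaired'.1 Nat.Primrec.pow

theorem computable_two_pow {f : α → ℕ} (hf : Computable f) : Computable fun a => 2 ^ f a :=
  primrec_nat_pow.to_comp.comp (Computable.const 2) hf

theorem computable_nat_mod {f g : α → ℕ} (hf : Computable f) (hg : Computable g) :
    Computable fun a => f a % g a := Primrec.nat_mod.to_comp.comp hf hg

theorem computable_lt {f g : α → ℕ} (hf : Computable f) (hg : Computable g) :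
    Computable fun a => decide (f a < g a) := by
  have h : Primrec₂ fun a b : ℕ => decide (a < b) := Primrec.nat_lt.decide
  exact h.to_comp.comp hf hg

theorem computable_eq [DecidableEq σ] {f g : α → σ} (hf : Computable f) (hg : Computable g) :
    Computable fun a => decide (f a = g a) := by
  have h : Primrec₂ fun a b : σ => decide (a = b) := Primrec.eq.decide
  exact h.to_comp.comp hf hg

theorem computable_and {p q : α → Prop} [DecidablePred p] [DecidablePred q]
    (hp : Computable fun a => decide (p a)) (hq : Computable fun a => decide (q a)) :
    Computable fun a => decide (p a ∧ q a) :=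
  (Primrec.and.to_comp.comp hp hq).of_eq fun a => by simp

theorem computable_or {p q : α → Prop} [DecidablePred p] [DecidablePred q]
    (hp : Computable fun a => decide (p a)) (hq : Computable fun a => decide (q a)) :
    Computable fun a => decide (p a ∨ q a) :=
  (Primrec.or.to_comp.comp hp hq).of_eq fun a => by simp

theorem computable_ite {p : α → Prop} [DecidablePred p] {f g : α → σ}
    (hp : Computable fun a => decide (p a)) (hf : Computable f) (hg : Computable g) :
    Computable fun a => if p a then f a else g a :=
  (Computable.cond hp hf hg).of_eq fun a => by by_cases h : p a <;> simp [h]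

theorem computable_sum_range {f : α → ℕ} {g : α → ℕ → ℕ} (hf : Computable f)
    (hg : Computable₂ g) : Computable fun a => ∑ i ∈ Finset.range (f a), g a i := by
  have h : Computable fun a => Nat.rec (motive := fun _ => ℕ) 0
      (fun n s => s + g a n) (f a) :=
    Computable.nat_rec (h := fun a (p : ℕ × ℕ) => p.2 + g a p.1) hf (Computable.const 0)
      (computable_nat_add (Computable.snd.comp Computable.snd)
        (hg.comp Computable.fst (Computable.fst.comp Computable.snd)))
  refine h.of_eq fun a => ?_
  induction f a with
  | zero => rfl
  | succ n ih => rw [Finset.sum_range_succ, ← ih]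

theorem computable_forall_lt {f : α → ℕ} {p : α → ℕ → Prop} [∀ a i, Decidable (p a i)]
    (hf : Computable f) (hp : Computable₂ fun a i => decide (p a i)) :
    Computable fun a => decide (∀ i < f a, p a i) := by
  have h : Computable fun a => Nat.rec (motive := fun _ => Bool) true
      (fun n s => s && decide (p a n)) (f a) :=
    Computable.nat_rec (h := fun a (q : ℕ × Bool) => q.2 && decide (p a q.1)) hf
      (Computable.const true)
      (Primrec.and.to_comp.comp (Computable.snd.comp Computable.snd)
        (hp.comp Computable.fst (Computable.fst.comp Computable.snd)))
  refine h.of_eq fun a => ?_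
  induction f a with
  | zero => simp
  | succ n ih =>
    simp only [ih]
    rw [Bool.eq_iff_iff, decide_eq_true_iff, Nat.forall_lt_succ_right]
    simp

theorem computable_testBit {f g : α → ℕ} (hf : Computable f) (hg : Computable g) :
    Computable fun a => (f a).testBit (g a) := by
  have h : Computable fun a => decide (f a / 2 ^ g a % 2 = 1) :=
    computable_eq (computable_nat_mod
      (Primrec.nat_div.to_comp.comp hf (computable_two_pow hg)) (Computable.const 2))
      (Computable.const 1)
  exact h.of_eq fun a => Nat.testBit_eq_decide_div_mod_eq.symm

theorem computable_getD {f : α → List ℕ} {g : α → ℕ} (hf : Computable f) (hg : Computable g) :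
    Computable fun a => (f a).getD (g a) 0 := (Primrec.list_getD 0).to_comp.comp hf hg

theorem computable_list_sum {f : α → List ℕ} (hf : Computable f) :
    Computable fun a => (f a).sum := by
  have h : Primrec fun l : List ℕ => l.foldr (fun b s => b + s) 0 :=
    Primrec.list_foldr (h := fun _ (p : ℕ × ℕ) => p.1 + p.2) Primrec.id (Primrec.const 0)
      (Primrec.nat_add.comp (Primrec.fst.comp Primrec.snd) (Primrec.snd.comp Primrec.snd))
  exact (h.to_comp.comp hf).of_eq fun a => rfl

theorem computable_toNat {f : α → ℤ} (hf : Computable f) : Computable fun a => (f a).toNat := by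
  -- Even numbers `2 * m` encode the integers `m ≥ 0`, odd numbers the negative ones.
  have h : Primrec fun m : ℕ => if m % 2 = 0 then m / 2 else 0 :=
    Primrec.ite (Primrec.eq.comp (Primrec.nat_mod.comp Primrec.id (Primrec.const 2))
      (Primrec.const 0)) (Primrec.nat_div.comp Primrec.id (Primrec.const 2)) (Primrec.const 0)
  refine (h.to_comp.comp (Computable.encode.comp hf)).of_eq fun a => ?_
  have e : ∀ z : ℤ, Encodable.encode z = Equiv.intEquivNat z := fun z => rfl
  rw [e]
  rcases f a with m | m
  · change (if Nat.bit false m % 2 = 0 then Nat.bit false m / 2 else 0) = m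
    simp
  · change (if Nat.bit true m % 2 = 0 then Nat.bit true m / 2 else 0) = 0
    simp

end Computability

/-! ### Initial segments, cylinders and their masses. -/

theorem initSeg_eq_map (σ : Cantor) (n : ℕ) : initSeg σ n = (List.range n).map σ := by
  apply List.ext_getElem <;> simp [initSeg]

@[simp] theorem length_initSeg (σ : Cantor) (n : ℕ) : (initSeg σ n).length = n := by
  simp [initSeg]

theorem initSeg_succ (σ : Cantor) (n : ℕ) : initSeg σ (n + 1) = initSeg σ n ++ [σ n] := by
  simp [initSeg_eq_map, List.range_succ]

theorem initSeg_eq_iff {σ τ : Cantor} {n : ℕ} :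
    initSeg σ n = initSeg τ n ↔ ∀ t < n, σ t = τ t := by
  simp [initSeg_eq_map]

theorem mem_cyl_initSeg {σ τ : Cantor} {n : ℕ} :
    τ ∈ cyl (initSeg σ n) ↔ ∀ t < n, τ t = σ t := by
  rw [← initSeg_eq_iff]
  simp [cyl]

theorem exists_initSeg_eq (w : List Bool) : ∃ σ, initSeg σ w.length = w :=
  ⟨fun i => w.getD i false, by apply List.ext_getElem <;> simp +contextual [initSeg]⟩

theorem isOpen_cyl (w : List Bool) : IsOpen (cyl w) := by
  have h := cyl_ofFn w.get
  rw [List.ofFn_get] at h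
  rw [h]
  exact (isOpen_discrete _).preimage (by fun_prop)

theorem measurableSet_cyl (w : List Bool) : MeasurableSet (cyl w) := (isOpen_cyl w).measurableSet

theorem mass_nonneg (ν : Source) (w : List Bool) : 0 ≤ mass ν w := measureReal_nonneg

theorem mass_le_one (ν : Source) (w : List Bool) : mass ν w ≤ 1 := measureReal_le_one

theorem mass_eq_add (ν : Source) (w : List Bool) :
    mass ν w = mass ν (w ++ [false]) + mass ν (w ++ [true]) := by
  have key : ∀ b, cyl (w ++ [b]) = {σ | σ ∈ cyl w ∧ σ w.length = b} := fun b => by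
    ext σ
    simp [cyl, initSeg_succ]
  unfold mass
  rw [← measureReal_union _ (measurableSet_cyl _)]
  · congr 1
    ext σ
    rw [key, key]
    cases h : σ w.length <;> simp [h]
  · rw [key, key, Set.disjoint_left]
    rintro σ ⟨-, h⟩ ⟨-, h'⟩
    simp [h] at h'

theorem IsForecaster.mass_pos {μ : Source} (hF : IsForecaster μ) (w : List Bool) :
    0 < mass μ w := by
  obtain ⟨σ, hσ⟩ := exists_initSeg_eq w
  have : (μ : Measure Cantor).IsOpenPosMeasure := hF
  exact ENNReal.toReal_pos ((isOpen_cyl w).measure_pos _ ⟨σ, hσ⟩).ne' (measure_ne_top _ _)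

/-! ### A computable bit that the forecaster considers unlikely. -/

/-- Whether a bit has conditional probability at most 1/2 is undecidable from approximations. The
slack up to 5/8 lets a search over bits and precisions stop at a certified inequality. -/
theorem exists_computable_unlikely_bit {μ : Source} (hμ : IsComputableSource μ)
    (hF : IsForecaster μ) :
    ∃ b : List Bool → Bool, Computable b ∧ ∀ w, mass μ (w ++ [b w]) < 5 / 8 * mass μ w := by
  obtain ⟨F, ⟨hnum, hden⟩, hF'⟩ := hμ
  set N : List Bool × ℕ → ℕ := fun x => (F x).num.toNat with hN
  set D : List Bool × ℕ → ℕ := fun x => (F x).den with hD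
  have hNc : Computable N := computable_toNat hnum
  have hDpos : ∀ x, (0 : ℝ) < D x := fun x => by exact_mod_cast (F x).den_pos
  have happrox : ∀ w t, |mass μ w - N (w, t) / D (w, t)| < (2 : ℝ)⁻¹ ^ t := fun w t => by
    refine lt_of_le_of_lt ?_ (hF' w t)
    have h1 : (F (w, t) : ℝ) = (F (w, t)).num / D (w, t) := by rw [Rat.cast_def]
    rcases le_total 0 (F (w, t)).num with h | h
    · have h2 : (N (w, t) : ℝ) = (F (w, t)).num := by
        have : ((N (w, t) : ℤ)) = (F (w, t)).num := Int.toNat_of_nonneg h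
        exact_mod_cast this
      rw [h1, h2]
    · have h2 : N (w, t) = 0 := Int.toNat_of_nonpos h
      have h3 : (F (w, t) : ℝ) ≤ 0 := by exact_mod_cast Rat.num_nonpos.1 h
      have h4 := mass_nonneg μ w
      rw [h2, Nat.cast_zero, zero_div, sub_zero, abs_of_nonneg h4, abs_of_nonneg (by linarith)]
      linarith
  let P : List Bool → ℕ → Bool := fun w m =>
    -- The number `m` codes a candidate bit (its last binary digit) and a precision.
    let x := (m.bodd, m.div2)
    -- The constant 13 = 8 + 5 collects the approximation errors of both sides, after denominators
    -- are cleared.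
    decide (8 * 2 ^ x.2 * N (w ++ [x.1], x.2) * D (w, x.2) + 13 * D (w ++ [x.1], x.2) * D (w, x.2)
      < 5 * 2 ^ x.2 * N (w, x.2) * D (w ++ [x.1], x.2))
  have hP : Computable₂ P := by
    have hx : Computable fun z : List Bool × ℕ => (z.2.bodd, z.2.div2) :=
      (Computable.nat_bodd.pair Computable.nat_div2).comp Computable.snd
    have ht := Computable.snd.comp hx
    have hw : Computable fun z : List Bool × ℕ => (z.1, (z.2.bodd, z.2.div2).2) :=
      Computable.fst.pair ht
    have hwb : Computable fun z : List Bool × ℕ =>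
        (z.1 ++ [(z.2.bodd, z.2.div2).1], (z.2.bodd, z.2.div2).2) :=
      (Computable.list_append.comp Computable.fst (Computable.list_cons.comp
        (Computable.fst.comp hx) (Computable.const []))).pair ht
    have hp := computable_two_pow ht
    exact computable_lt (computable_nat_add
      (computable_nat_mul (computable_nat_mul (computable_nat_mul (Computable.const 8) hp)
        (hNc.comp hwb)) (hden.comp hw))
      (computable_nat_mul (computable_nat_mul (Computable.const 13) (hden.comp hwb))
        (hden.comp hw)))
      (computable_nat_mul (computable_nat_mul (computable_nat_mul (Computable.const 5) hp)
        (hNc.comp hw)) (hden.comp hwb))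
  have hiff : ∀ w b t, P w (Nat.bit b t) = true ↔
      8 * ((N (w ++ [b], t) : ℝ) / D (w ++ [b], t) + 2⁻¹ ^ t)
        < 5 * (N (w, t) / D (w, t) - 2⁻¹ ^ t) := fun w b t => by
    have e1 : P w (Nat.bit b t) = true ↔ (8 * 2 ^ t * N (w ++ [b], t) * D (w, t)
        + 13 * D (w ++ [b], t) * D (w, t) : ℝ) < 5 * 2 ^ t * N (w, t) * D (w ++ [b], t) := by
      simp only [P, Nat.bodd_bit, Nat.div2_bit, decide_eq_true_iff]
      exact_mod_cast Iff.rfl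
    rw [e1]
    have d1 := hDpos (w ++ [b], t)
    have d2 := hDpos (w, t)
    have d3 : (0 : ℝ) < 2 ^ t := by positivity
    have c : (0 : ℝ) < D (w ++ [b], t) * D (w, t) * 2 ^ t := by positivity
    have e2 : (8 * 2 ^ t * N (w ++ [b], t) * D (w, t) + 13 * D (w ++ [b], t) * D (w, t) : ℝ) =
        (8 * (N (w ++ [b], t) / D (w ++ [b], t)) + 13 * 2⁻¹ ^ t) *
          (D (w ++ [b], t) * D (w, t) * 2 ^ t) := by
      rw [inv_pow]
      field_simp
    have e3 : (5 * 2 ^ t * N (w, t) * D (w ++ [b], t) : ℝ) =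
        5 * (N (w, t) / D (w, t)) * (D (w ++ [b], t) * D (w, t) * 2 ^ t) := by
      field_simp
    rw [e2, e3, mul_lt_mul_iff_left₀ c]
    constructor <;> intro h <;> linarith
  have hex : ∀ w, ∃ m, P w m = true := fun w => by
    have hm := hF.mass_pos w
    -- With error `ε = 2⁻ᵗ` the test needs `4 * m + 16 * ε < 5 * m - 10 * ε` for `m = mass μ w`,
    -- whence 26.
    obtain ⟨t, ht⟩ := exists_pow_lt_of_lt_one (show 0 < mass μ w / 26 by positivity)
      (show (2 : ℝ)⁻¹ < 1 by norm_num)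
    obtain ⟨b, hb⟩ : ∃ b, mass μ (w ++ [b]) ≤ mass μ w / 2 := by
      by_contra! hc
      have := hc false
      have := hc true
      have := mass_eq_add μ w
      linarith
    refine ⟨Nat.bit b t, (hiff w b t).2 ?_⟩
    have a1 := abs_lt.1 (happrox (w ++ [b]) t)
    have a2 := abs_lt.1 (happrox w t)
    linarith [a1.1, a2.2]
  refine ⟨fun w => (Nat.find (hex w)).bodd,
    Computable.nat_bodd.comp (computable_nat_find hP hex), fun w => ?_⟩
  have h := Nat.find_spec (hex w)
  rw [← Nat.bit_bodd_div2 (Nat.find (hex w)), hiff] at h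
  have a1 := abs_lt.1 (happrox (w ++ [(Nat.find (hex w)).bodd]) (Nat.find (hex w)).div2)
  have a2 := abs_lt.1 (happrox w (Nat.find (hex w)).div2)
  linarith [a1.2, a2.1]

/-! ### Dirac mixtures as extreme cases of sources with prescribed lower bounds. -/

noncomputable section

/-- The sequence whose first `n` bits are those of `i` and whose other bits are those of `τ`. -/
def splice (n i : ℕ) (τ : Cantor) : Cantor := fun t => if t < n then i.testBit t else τ t

/-- The mixture, with weights `a i` and `1`, of the point masses at the sequences `splice n i τ`
for `i < 2 ^ n` and at `τ`. -/
def diracMixture (n : ℕ) (a : ℕ → ℕ) (τ : Cantor) : Source :=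
  ⟨((∑ i ∈ Finset.range (2 ^ n), a i + 1 : ℕ) : ENNReal)⁻¹ •
      (∑ i ∈ Finset.range (2 ^ n), (a i : ENNReal) • Measure.dirac (splice n i τ) +
        Measure.dirac τ), ⟨by
    simp only [Measure.smul_apply, Measure.add_apply, Measure.finsetSum_apply, smul_eq_mul,
      measure_univ, mul_one]
    rw [Nat.cast_add, Nat.cast_sum, Nat.cast_one]
    refine ENNReal.inv_mul_cancel (by simp) ?_
    simp [ENNReal.sum_eq_top]⟩⟩

/-- The unnormalized mass that `diracMixture n a τ` gives to `B_w`. -/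
def hits (n : ℕ) (a : ℕ → ℕ) (τ : Cantor) (w : List Bool) : ℕ :=
  ∑ i ∈ Finset.range (2 ^ n), (if initSeg (splice n i τ) w.length = w then a i else 0) +
    if initSeg τ w.length = w then 1 else 0

theorem mass_diracMixture (n : ℕ) (a : ℕ → ℕ) (τ : Cantor) (w : List Bool) :
    mass (diracMixture n a τ) w =
      hits n a τ w / (∑ i ∈ Finset.range (2 ^ n), a i + 1 : ℕ) := by
  have hd : ∀ σ : Cantor, Measure.dirac σ (cyl w) =
      if initSeg σ w.length = w then (1 : ENNReal) else 0 := fun σ => by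
    rw [Measure.dirac_apply' _ (measurableSet_cyl w)]
    by_cases h : initSeg σ w.length = w <;> simp [Set.indicator, cyl, h]
  have h : (diracMixture n a τ : Measure Cantor) (cyl w) =
      ((∑ i ∈ Finset.range (2 ^ n), a i + 1 : ℕ) : ENNReal)⁻¹ * (hits n a τ w : ENNReal) := by
    simp only [diracMixture, ProbabilityMeasure.coe_mk, Measure.smul_apply, Measure.add_apply,
      Measure.finsetSum_apply, smul_eq_mul, hd, hits]
    push_cast
    simp
  rw [mass, measureReal_def, h, ENNReal.toReal_mul, ENNReal.toReal_inv, ENNReal.toReal_natCast,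
    ENNReal.toReal_natCast, inv_mul_eq_div]

/-- The numbers `i < 2 ^ n`, read through `testBit`, enumerate the strings of length `n`; their
cylinders are disjoint. -/
theorem sum_le_measureReal_of_cyl_subset {n : ℕ} {f : ℕ → ℝ} {ν : Source}
    (hν : ∀ i < 2 ^ n, f i ≤ mass ν (initSeg i.testBit n)) {S : Finset ℕ}
    (hS : S ⊆ Finset.range (2 ^ n)) {E : Set Cantor}
    (hE : ∀ i ∈ S, cyl (initSeg i.testBit n) ⊆ E) :
    ∑ i ∈ S, f i ≤ (ν : Measure Cantor).real E := by
  have hdisj : Set.PairwiseDisjoint (S : Set ℕ) fun i => cyl (initSeg i.testBit n) := by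
    intro i hi j hj hij
    rw [Function.onFun, Set.disjoint_left]
    intro σ h1 h2
    rw [mem_cyl_initSeg] at h1 h2
    refine hij (Nat.eq_of_testBit_eq fun t => ?_)
    rcases lt_or_ge t n with ht | ht
    · rw [← h1 t ht, h2 t ht]
    · have hi' := Finset.mem_range.1 (hS hi)
      have hj' := Finset.mem_range.1 (hS hj)
      have := Nat.pow_le_pow_right (n := 2) (by norm_num) ht
      rw [Nat.testBit_lt_two_pow (by omega), Nat.testBit_lt_two_pow (by omega)]
  calc ∑ i ∈ S, f i ≤ ∑ i ∈ S, (ν : Measure Cantor).real (cyl (initSeg i.testBit n)) :=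
        Finset.sum_le_sum fun i hi => hν i (Finset.mem_range.1 (hS hi))
    _ = (ν : Measure Cantor).real (⋃ i ∈ S, cyl (initSeg i.testBit n)) :=
        (measureReal_biUnion_finset hdisj fun i _ => measurableSet_cyl _).symm
    _ ≤ _ := measureReal_mono (Set.iUnion₂_subset hE)

/-- The measures that exceed the unnormalized weights `a` of level `n` lie, cylinder by cylinder,
between Dirac mixtures. -/
theorem exists_mass_diracMixture_le {n : ℕ} {a : ℕ → ℕ} {ν : Source}
    (hν : ∀ i < 2 ^ n, (a i : ℝ) / (∑ i ∈ Finset.range (2 ^ n), a i + 1 : ℕ) ≤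
      mass ν (initSeg i.testBit n)) (w : List Bool) :
    ∃ τ, mass (diracMixture n a τ) w ≤ mass ν w := by
  obtain ⟨σ, hσ⟩ := exists_initSeg_eq w
  rcases w.eq_nil_or_concat with hw | ⟨v, b, hw⟩
  -- The empty string is separate: no `τ` avoids its cylinder.
  · refine ⟨σ, (mass_le_one _ _).trans ?_⟩
    have : cyl w = Set.univ := by ext; simp [hw, cyl, initSeg]
    simp [mass, this]
  have hlen : 0 < w.length := by simp [hw]
  -- With opposite bits, `τ` misses `B_w`, and a splice hits it only if `w` has length at most `n`;
  -- then the whole cylinder of `i` lies in `B_w`.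
  refine ⟨fun t => !σ t, ?_⟩
  rw [mass_diracMixture, hits, if_neg, add_zero, ← Finset.sum_filter, Nat.cast_sum, Finset.sum_div]
  · refine sum_le_measureReal_of_cyl_subset hν (Finset.filter_subset _ _) fun i hi ρ hρ => ?_
    have hi := (Finset.mem_filter.1 hi).2
    rw [← hσ, length_initSeg, initSeg_eq_iff] at hi
    rw [mem_cyl_initSeg] at hρ
    rw [← hσ, mem_cyl_initSeg]
    intro t ht
    have := hi t ht
    by_cases htn : t < n
    · rw [hρ t htn, ← this, splice, if_pos htn]
    · simp [splice, htn] at this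
  · rw [← hσ, length_initSeg, initSeg_eq_iff]
    intro h
    simpa using h 0 hlen

/-- Here `τ` itself begins with `w`, so a splice misses `B_w` only when its first `n` bits already
conflict with `w`. The lower bound is applied to the complement of `B_w`. -/
theorem exists_le_mass_diracMixture {n : ℕ} {a : ℕ → ℕ} {ν : Source}
    (hν : ∀ i < 2 ^ n, (a i : ℝ) / (∑ i ∈ Finset.range (2 ^ n), a i + 1 : ℕ) ≤
      mass ν (initSeg i.testBit n)) (w : List Bool) :
    ∃ τ, mass ν w ≤ mass (diracMixture n a τ) w := by
  obtain ⟨σ, hσ⟩ := exists_initSeg_eq w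
  refine ⟨σ, ?_⟩
  set A : ℕ := ∑ i ∈ Finset.range (2 ^ n), a i with hA
  have h := sum_le_measureReal_of_cyl_subset hν (E := (cyl w)ᶜ)
    (Finset.filter_subset (fun i => ¬ initSeg (splice n i σ) w.length = w) _) fun i hi ρ hρ hρw => by
      have hi := (Finset.mem_filter.1 hi).2
      rw [← hσ, mem_cyl_initSeg] at hρw
      rw [mem_cyl_initSeg] at hρ
      rw [← hσ, length_initSeg, initSeg_eq_iff] at hi
      refine hi fun t ht => ?_
      rw [splice]
      split_ifs with htn
      · rw [← hρ t htn, hρw t ht]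
      · rfl
  rw [measureReal_compl (measurableSet_cyl w), probReal_univ] at h
  have hsum : (hits n a σ w : ℝ) + ∑ i ∈ Finset.range (2 ^ n) with
      ¬ initSeg (splice n i σ) w.length = w, (a i : ℝ) = (A + 1 : ℕ) := by
    rw [hits, if_pos hσ, ← Finset.sum_filter, hA, ← Finset.sum_filter_add_sum_filter_not
      (Finset.range (2 ^ n)) (fun i => initSeg (splice n i σ) w.length = w) a]
    push_cast
    ring
  have hpos : (0 : ℝ) < (A + 1 : ℕ) := by positivity
  rw [← Finset.sum_div, div_le_iff₀ hpos] at h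
  rw [mass_diracMixture, le_div_iff₀ hpos]
  change _ ≤ (1 - mass ν w) * _ at h
  linarith

/-- This reduces the quantifier over all `τ` in `Admissible` to finitely many cases. -/
theorem hits_congr {n : ℕ} {a : ℕ → ℕ} {τ τ' : Cantor} {w : List Bool}
    (h : ∀ t < w.length, τ t = τ' t) : hits n a τ w = hits n a τ' w := by
  have h1 : ∀ i, initSeg (splice n i τ) w.length = initSeg (splice n i τ') w.length := fun i => by
    rw [initSeg_eq_iff]
    intro t ht
    simp [splice, h t ht]
  simp only [hits, h1, initSeg_eq_iff.2 h]

theorem sum_ofBits {M : Type*} [AddCommMonoid M] {k : ℕ} (f : ℕ → M) :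
    ∑ w : Fin k → Bool, f (Nat.ofBits w) = ∑ i ∈ Finset.range (2 ^ k), f i := by
  refine Finset.sum_bij' (fun w _ => Nat.ofBits w) (fun i _ => fun j : Fin k => i.testBit j)
    (fun w _ => Finset.mem_range.2 (Nat.ofBits_lt_two_pow w)) (fun _ _ => Finset.mem_univ _)
    ?_ ?_ (fun _ _ => rfl)
  · intro w _
    funext j
    exact Nat.testBit_ofBits_lt w j j.2
  · intro i hi
    simp only [Nat.ofBits_testBit]
    exact Nat.mod_eq_of_lt (Finset.mem_range.1 hi)

theorem sum_range_getD {a : List ℕ} {m : ℕ} (h : a.length = m) :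
    ∑ i ∈ Finset.range m, a.getD i 0 = a.sum := by
  subst h
  rw [Finset.sum_range, ← List.sum_ofFn]
  congr 1
  apply List.ext_getElem <;> simp

/-! ### Admissible weights: existence, decidability, independence of the code. -/

/-- The arithmetical conditions for a code to be the code of a set. -/
def ValidCode (c : Code) : Prop :=
  c.2.1.length = 2 ^ c.1 ∧ 0 < c.2.1.sum ∧ 0 < c.2.2.1 ∧ 0 < c.2.2.2

instance : DecidablePred ValidCode := fun _ => inferInstanceAs (Decidable (_ ∧ _))

theorem IsCode.validCode {c : Code} {W : Set Source} (h : IsCode c W) : ValidCode c := by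
  obtain ⟨k, a, p, q⟩ := c
  obtain ⟨hl, hp, hq, m, hm, -⟩ := h
  refine ⟨hl, Nat.pos_of_ne_zero fun h0 => ?_, hp, hq⟩
  simp only at h0
  have h1 := m.2.2
  simp [hm, h0] at h1

theorem ValidCode.exists_isCode {c : Code} (h : ValidCode c) : ∃ W, IsCode c W := by
  obtain ⟨k, a, p, q⟩ := c
  obtain ⟨hl, hs, hp, hq⟩ := h
  simp only at hl hs hp hq
  have hs' : (a.sum : ℝ) ≠ 0 := by exact_mod_cast hs.ne'
  exact ⟨_, hl, hp, hq, ⟨fun w => (a.getD (Nat.ofBits w) 0 : ℝ) / (a.sum : ℝ),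
    fun w => by positivity, by
      rw [← Finset.sum_div, sum_ofBits fun i => (a.getD i 0 : ℝ), ← Nat.cast_sum,
        sum_range_getD hl, div_self hs']⟩, fun w => rfl, rfl⟩

theorem IsCode.mem_iff {k p q : ℕ} {a : List ℕ} {W : Set Source} (h : IsCode (k, a, p, q) W)
    {ν : Source} : ν ∈ W ↔ ∀ w : Fin k → Bool,
      |mass ν (List.ofFn w) - a.getD (Nat.ofBits w) 0 / a.sum| < (p : ℝ) / q := by
  obtain ⟨-, hp, hq, m, hm, rfl⟩ := h
  rw [Set.mem_preimage, Metric.mem_ball, Subtype.dist_eq, dist_pi_lt_iff (by positivity)]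
  exact forall_congr' fun w => by rw [hm, Real.dist_eq]; rfl

/-- `x` consists of a level `n` and a list of `2 ^ n` weights all of whose Dirac mixtures
belong to `W`. -/
def Admissible (x : ℕ × List ℕ) (W : Set Source) : Prop :=
  x.2.length = 2 ^ x.1 ∧ 0 < x.2.sum ∧ ∀ τ, diracMixture x.1 (fun i => x.2.getD i 0) τ ∈ W

/-- A basic set constrains the mass of each string to an interval, so each mass may be squeezed
between those of two mixtures, with `τ` depending on the string. -/
theorem Admissible.mem {x : ℕ × List ℕ} {W : Set Source} (hx : Admissible x W)
    (hW : W ∈ basisW) {ν : Source} (hν : ∀ i < 2 ^ x.1,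
      (x.2.getD i 0 : ℝ) / (x.2.sum + 1) ≤ mass ν (initSeg i.testBit x.1)) : ν ∈ W := by
  obtain ⟨n, a⟩ := x
  obtain ⟨⟨k, b, p, q⟩, hc⟩ := exists_isCode hW
  have hτ := hx.2.2
  simp only [hc.mem_iff] at hτ hν ⊢
  have hsum := sum_range_getD hx.1
  simp only at hsum
  have hν' : ∀ i < 2 ^ n, (a.getD i 0 : ℝ) / (∑ i ∈ Finset.range (2 ^ n), a.getD i 0 + 1 : ℕ) ≤
      mass ν (initSeg i.testBit n) := by
    rw [hsum]
    exact_mod_cast hν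
  intro w
  obtain ⟨τ, h1⟩ := exists_mass_diracMixture_le hν' (List.ofFn w)
  obtain ⟨τ', h2⟩ := exists_le_mass_diracMixture hν' (List.ofFn w)
  have h3 := abs_lt.1 (hτ τ w)
  have h4 := abs_lt.1 (hτ τ' w)
  rw [abs_lt]
  constructor <;> linarith [h3.1, h4.2]

/-- The arithmetical form of `Admissible x W` in terms of a code `c` of `W`. -/
def AdmissibleFor (c : Code) (x : ℕ × List ℕ) : Prop :=
  x.2.length = 2 ^ x.1 ∧ 0 < x.2.sum ∧ ∀ j < 2 ^ c.1, ∀ u < 2 ^ c.1,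
    c.2.2.2 * (hits x.1 (fun i => x.2.getD i 0) j.testBit (initSeg u.testBit c.1) * c.2.1.sum) <
      c.2.2.1 * ((x.2.sum + 1) * c.2.1.sum) + c.2.2.2 * (c.2.1.getD u 0 * (x.2.sum + 1)) ∧
    c.2.2.2 * (c.2.1.getD u 0 * (x.2.sum + 1)) < c.2.2.1 * ((x.2.sum + 1) * c.2.1.sum) +
      c.2.2.2 * (hits x.1 (fun i => x.2.getD i 0) j.testBit (initSeg u.testBit c.1) * c.2.1.sum)

instance : DecidableRel AdmissibleFor := fun _ _ => inferInstanceAs (Decidable (_ ∧ _))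

/-- Both inequalities are written with sums only, to avoid truncated subtraction. -/
theorem abs_div_sub_div_lt_div_iff {h s b t p q : ℕ} (hs : 0 < s) (ht : 0 < t) (hq : 0 < q) :
    |(h : ℝ) / s - b / t| < (p : ℝ) / q ↔
      q * (h * t) < p * (s * t) + q * (b * s) ∧ q * (b * s) < p * (s * t) + q * (h * t) := by
  have hc : (0 : ℝ) < s * t * q := by positivity
  rw [abs_lt, and_comm, ← sub_pos (a := (p : ℝ) / q), ← sub_pos (b := -((p : ℝ) / q))]
  rify
  have hs' : (s : ℝ) ≠ 0 := by positivity
  have ht' : (t : ℝ) ≠ 0 := by positivity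
  have hq' : (q : ℝ) ≠ 0 := by positivity
  have e1 : ((p : ℝ) / q - (h / s - b / t)) * (s * t * q) =
      p * (s * t) + q * (b * s) - q * (h * t) := by
    field_simp
    ring
  have e2 : ((h : ℝ) / s - b / t - -(p / q)) * (s * t * q) =
      p * (s * t) + q * (h * t) - q * (b * s) := by
    field_simp
    ring
  rw [← sub_pos (a := (p : ℝ) * _ + _ * (b * s)), ← sub_pos (a := (p : ℝ) * _ + _ * (h * t)),
    ← e1, ← e2]
  exact and_congr (mul_pos_iff_of_pos_right hc).symm (mul_pos_iff_of_pos_right hc).symm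

theorem admissibleFor_iff {c : Code} {W : Set Source} (hc : IsCode c W) (x : ℕ × List ℕ) :
    AdmissibleFor c x ↔ Admissible x W := by
  have hv := hc.validCode
  obtain ⟨k, b, p, q⟩ := c
  obtain ⟨n, a⟩ := x
  refine and_congr_right fun hl => and_congr_right fun _ => ?_
  have hsum := sum_range_getD hl
  simp only at hsum
  simp only [hc.mem_iff, mass_diracMixture, hsum]
  have key : ∀ (j : Cantor) (w : Fin k → Bool), _ ↔ _ := fun j w =>
    abs_div_sub_div_lt_div_iff (h := hits n (fun i => a.getD i 0) j (List.ofFn w))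
    (b := b.getD (Nat.ofBits w) 0) (p := p) (Nat.succ_pos a.sum) hv.2.1 hv.2.2.2
  have hw : ∀ w : Fin k → Bool, initSeg (Nat.ofBits w).testBit k = List.ofFn w := fun w => by
    simp [initSeg, Nat.testBit_ofBits_lt]
  constructor
  · intro h τ w
    refine (key τ w).2 ?_
    have h' := h (Nat.ofBits fun i : Fin k => τ i) (Nat.ofBits_lt_two_pow _) (Nat.ofBits w)
      (Nat.ofBits_lt_two_pow _)
    rw [hw, hits_congr (τ' := τ)] at h'
    · exact h'
    · intro t ht
      rw [List.length_ofFn] at ht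
      exact Nat.testBit_ofBits_lt _ t ht
  · intro h j _ u hu
    have h' := (key _ _).1 (h j.testBit fun i : Fin k => u.testBit i)
    rw [Nat.ofBits_testBit, Nat.mod_eq_of_lt hu] at h'
    exact h'

theorem exists_admissibleFor {c : Code} (hc : ValidCode c) : ∃ x, AdmissibleFor c x := by
  obtain ⟨k, b, p, q⟩ := c
  obtain ⟨hl, hs, hp, hq⟩ := hc
  simp only at hl hs hp hq
  have hsum : (b.map fun x => q * x).sum = q * b.sum := by
    simpa using List.sum_map_mul_left (l := b) (f := fun x => x) (r := q)
  -- Scaling the centre's weights by `q` makes the extra unit of weight harmless: it moves each mass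
  -- by at most `1 / (q * B + 1) < p / q`, where `B` is the sum of `b`.
  refine ⟨(k, b.map fun x => q * x), by simpa using hl, by simp only [hsum]; positivity,
    fun j hj u hu => ?_⟩
  simp only at hj hu
  have hget : ∀ i, (b.map fun x => q * x).getD i 0 = q * b.getD i 0 := fun i => by
    rw [List.getD_eq_getElem?_getD, List.getD_eq_getElem?_getD, List.getElem?_map]
    cases b[i]? <;> simp
  -- At level `k` the only splice in the cylinder of `u` is that of `u`; `θ` is the possible
  -- contribution of `τ`.
  have hh : ∃ θ ≤ 1, hits k (fun i => (b.map fun x => q * x).getD i 0) j.testBit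
      (initSeg u.testBit k) = q * b.getD u 0 + θ := by
    refine ⟨if initSeg j.testBit k = initSeg u.testBit k then 1 else 0, by split_ifs <;> simp, ?_⟩
    simp only [hits, length_initSeg, hget]
    congr 1
    rw [Finset.sum_eq_single u]
    · rw [if_pos]
      rw [initSeg_eq_iff]
      intro t ht
      simp [splice, ht]
    · intro i hi hiu
      rw [if_neg]
      rw [initSeg_eq_iff]
      intro h
      refine hiu (Nat.eq_of_testBit_eq fun t => ?_)
      rcases lt_or_ge t k with ht | ht
      · simpa [splice, ht] using h t ht
      · have hi' := Finset.mem_range.1 hi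
        have := Nat.pow_le_pow_right (n := 2) (by norm_num) ht
        rw [Nat.testBit_lt_two_pow (by omega), Nat.testBit_lt_two_pow (by omega)]
    · intro h
      exact absurd (Finset.mem_range.2 hu) h
  obtain ⟨θ, hθ, hh⟩ := hh
  simp only [hh, hsum]
  have hbu : b.getD u 0 ≤ b.sum := by
    rw [← sum_range_getD hl]
    exact Finset.single_le_sum (f := fun i => b.getD i 0) (fun _ _ => Nat.zero_le _)
      (Finset.mem_range.2 hu)
  generalize b.getD u 0 = β at hbu
  generalize b.sum = B at hs hbu
  have h1 : q * (θ * B) ≤ q * B := by gcongr; nlinarith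
  have h2 : q * β ≤ q * B := by gcongr
  have h3 : q * B < (q * B + 1) * B := by nlinarith [Nat.le_mul_of_pos_right (q * B) hs]
  have h4 : (q * B + 1) * B ≤ p * ((q * B + 1) * B) := Nat.le_mul_of_pos_left _ hp
  have e1 : q * ((q * β + θ) * B) = q * (q * β * B) + q * (θ * B) := by ring
  have e2 : q * (β * (q * B + 1)) = q * (q * β * B) + q * β := by ring
  rw [e1, e2]
  constructor <;> omega

theorem computable_validCode : Computable fun c : Code => decide (ValidCode c) := by
  have hb : Computable fun c : Code => c.2.1 := Computable.fst.comp Computable.snd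
  have hpq : Computable fun c : Code => c.2.2 := Computable.snd.comp Computable.snd
  exact computable_and (computable_eq (Computable.list_length.comp hb)
    (computable_two_pow Computable.fst))
    (computable_and (computable_lt (Computable.const 0) (computable_list_sum hb))
    (computable_and (computable_lt (Computable.const 0) (Computable.fst.comp hpq))
    (computable_lt (Computable.const 0) (Computable.snd.comp hpq))))

theorem computable_initSeg_testBit {α : Type*} [Primcodable α] {f g : α → ℕ}
    (hf : Computable f) (hg : Computable g) :
    Computable fun x => initSeg (f x).testBit (g x) := by
  simp only [initSeg_eq_map]
  exact computable_map_range hg (computable_testBit (hf.comp Computable.fst) Computable.snd)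

theorem computable_hits {α : Type*} [Primcodable α] {n j u k : α → ℕ} {a : α → List ℕ}
    (hn : Computable n) (ha : Computable a) (hj : Computable j) (hu : Computable u)
    (hk : Computable k) : Computable fun x =>
      hits (n x) (fun i => (a x).getD i 0) (j x).testBit (initSeg (u x).testBit (k x)) := by
  simp only [hits, length_initSeg]
  have hw := computable_initSeg_testBit hu hk
  refine computable_nat_add (computable_sum_range (computable_two_pow hn) ?_)
    (computable_ite (computable_eq (computable_initSeg_testBit hj hk) hw) (Computable.const 1)
      (Computable.const 0))
  refine computable_ite (computable_eq ?_ (hw.comp Computable.fst))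
    (computable_getD (ha.comp Computable.fst) Computable.snd) (Computable.const 0)
  simp only [initSeg_eq_map]
  refine computable_map_range (hk.comp Computable.fst) ?_
  exact computable_ite (computable_lt Computable.snd ((hn.comp Computable.fst).comp Computable.fst))
    (computable_testBit (Computable.snd.comp Computable.fst) Computable.snd)
    (computable_testBit ((hj.comp Computable.fst).comp Computable.fst) Computable.snd)

theorem computable_admissibleFor :
    Computable fun z : Code × (ℕ × List ℕ) => decide (AdmissibleFor z.1 z.2) := by
  have hk : Computable fun z : Code × (ℕ × List ℕ) => z.1.1 :=
    Computable.fst.comp Computable.fst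
  have hb : Computable fun z : Code × (ℕ × List ℕ) => z.1.2.1 :=
    Computable.fst.comp (Computable.snd.comp Computable.fst)
  have hp : Computable fun z : Code × (ℕ × List ℕ) => z.1.2.2.1 :=
    Computable.fst.comp (Computable.snd.comp (Computable.snd.comp Computable.fst))
  have hq : Computable fun z : Code × (ℕ × List ℕ) => z.1.2.2.2 :=
    Computable.snd.comp (Computable.snd.comp (Computable.snd.comp Computable.fst))
  have hn : Computable fun z : Code × (ℕ × List ℕ) => z.2.1 :=
    Computable.fst.comp Computable.snd
  have ha : Computable fun z : Code × (ℕ × List ℕ) => z.2.2 :=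
    Computable.snd.comp Computable.snd
  have hs := computable_list_sum ha
  refine computable_and (computable_eq (Computable.list_length.comp ha) (computable_two_pow hn))
    (computable_and (computable_lt (Computable.const 0) hs)
    (computable_forall_lt (computable_two_pow hk)
    (computable_forall_lt (computable_two_pow (hk.comp Computable.fst)) ?_)))
  have lift {σ : Type} [Primcodable σ] {f : Code × (ℕ × List ℕ) → σ} (hf : Computable f) :
      Computable fun y : ((Code × (ℕ × List ℕ)) × ℕ) × ℕ => f y.1.1 :=
    hf.comp (Computable.fst.comp Computable.fst)
  have hj : Computable fun y : ((Code × (ℕ × List ℕ)) × ℕ) × ℕ => y.1.2 :=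
    Computable.snd.comp Computable.fst
  have hu : Computable fun y : ((Code × (ℕ × List ℕ)) × ℕ) × ℕ => y.2 := Computable.snd
  have hB := lift (computable_list_sum hb)
  have hS := computable_nat_add (lift hs) (Computable.const 1)
  have hH := computable_nat_mul (lift hq)
    (computable_nat_mul (computable_hits (lift hn) (lift ha) hj hu (lift hk)) hB)
  have hβ := computable_nat_mul (lift hq) (computable_nat_mul (computable_getD (lift hb) hu) hS)
  have hP := computable_nat_mul (lift hp) (computable_nat_mul hS hB)
  exact computable_and (computable_lt hH (computable_nat_add hP hβ))
    (computable_lt hβ (computable_nat_add hP hH))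

/-- A computable choice of admissible weights that depends only on the set, not on its code. -/
theorem exists_computable_admissible : ∃ f : Code → ℕ × List ℕ, Computable f ∧
    (∀ c W, IsCode c W → Admissible (f c) W) ∧
    ∀ c c' W, IsCode c W → IsCode c' W → f c = f c' := by
  let P : Code → ℕ → Bool := fun c m =>
    -- Accepting invalid codes at once makes the search total.
    decide (¬ ValidCode c ∨ AdmissibleFor c (Denumerable.ofNat (ℕ × List ℕ) m))
  have h1 : Computable fun z : Code × ℕ => decide (¬ ValidCode z.1) :=
    (Primrec.not.to_comp.comp (computable_validCode.comp Computable.fst)).of_eq fun z => by simp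
  have h2 : Computable fun z : Code × ℕ => (z.1, Denumerable.ofNat (ℕ × List ℕ) z.2) :=
    Computable.fst.pair ((Computable.ofNat _).comp Computable.snd)
  have h3 := computable_admissibleFor.comp h2
  have hP : Computable₂ P := computable_or h1 h3
  have hex : ∀ c, ∃ m, P c m = true := fun c => by
    by_cases hc : ValidCode c
    · obtain ⟨x, hx⟩ := exists_admissibleFor hc
      exact ⟨Encodable.encode x, decide_eq_true (Or.inr (by rwa [Denumerable.ofNat_encode]))⟩
    · exact ⟨0, by simp [P, hc]⟩
  refine ⟨fun c => Denumerable.ofNat (ℕ × List ℕ) (Nat.find (hex c)),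
    (Computable.ofNat _).comp (computable_nat_find hP hex), fun c W hc => ?_,
    fun c c' W hc hc' => ?_⟩
  · have h := of_decide_eq_true (Nat.find_spec (hex c))
    refine (admissibleFor_iff hc _).1 ?_
    exact h.resolve_left (not_not.2 hc.validCode)
  -- Codes of the same set pose the same search problem, so the least solutions coincide.
  · have h : P c = P c' := by
      funext m
      refine decide_eq_decide.2 ?_
      simp only [hc.validCode, hc'.validCode, admissibleFor_iff hc, admissibleFor_iff hc']
    simp only [h]

/-! ### Prolonging weights along the prescribed bits. -/

/-- The weight that `a` assigns to the first `n` bits of `σ` if the bits of `σ` from `n` up to `N`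
are those prescribed by `b`, and zero otherwise. -/
def pathWeight (b : List Bool → Bool) (n : ℕ) (a : List ℕ) (N : ℕ) (σ : Cantor) : ℕ :=
  if ∀ t < N, t < n ∨ σ t = b (initSeg σ t) then a.getD (Nat.ofBits fun i : Fin n => σ i) 0 else 0

section PathWeight

variable {b : List Bool → Bool} {n : ℕ} {a : List ℕ} {N : ℕ}

theorem pathWeight_congr (hn : n ≤ N) {σ τ : Cantor} (h : ∀ t < N, σ t = τ t) :
    pathWeight b n a N σ = pathWeight b n a N τ := by
  have h1 : (∀ t < N, t < n ∨ σ t = b (initSeg σ t)) ↔ ∀ t < N, t < n ∨ τ t = b (initSeg τ t) :=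
    forall₂_congr fun t ht => by
      rw [h t ht, initSeg_eq_iff.2 fun s hs => h s (hs.trans ht)]
  have h2 : (fun i : Fin n => σ i) = fun i : Fin n => τ i :=
    funext fun i => h i (i.2.trans_le hn)
  simp only [pathWeight, h1, h2]

theorem pathWeight_self (σ : Cantor) :
    pathWeight b n a n σ = a.getD (Nat.ofBits fun i : Fin n => σ i) 0 :=
  if_pos fun _ ht => Or.inl ht

theorem pathWeight_succ (hn : n ≤ N) (σ : Cantor) :
    pathWeight b n a (N + 1) σ = if σ N = b (initSeg σ N) then pathWeight b n a N σ else 0 := by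
  have : (∀ t < N + 1, t < n ∨ σ t = b (initSeg σ t)) ↔
      σ N = b (initSeg σ N) ∧ ∀ t < N, t < n ∨ σ t = b (initSeg σ t) := by
    rw [Nat.forall_lt_succ_right, and_comm, or_iff_right (not_lt.2 hn)]
  simp only [pathWeight, this, ite_and]

theorem initSeg_update (σ : Cantor) (N : ℕ) (s : Bool) :
    initSeg (Function.update σ N s) N = initSeg σ N :=
  initSeg_eq_iff.2 fun _ ht => Function.update_of_ne ht.ne _ _

theorem pathWeight_succ_update (hn : n ≤ N) (σ : Cantor) (s : Bool) :
    pathWeight b n a (N + 1) (Function.update σ N s) =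
      if s = b (initSeg σ N) then pathWeight b n a N σ else 0 := by
  rw [pathWeight_succ hn, initSeg_update, Function.update_self,
    pathWeight_congr hn fun t ht => Function.update_of_ne ht.ne _ _]

theorem pathWeight_eq_add (hn : n ≤ N) (σ : Cantor) :
    pathWeight b n a N σ = pathWeight b n a (N + 1) (Function.update σ N false) +
      pathWeight b n a (N + 1) (Function.update σ N true) := by
  rw [pathWeight_succ_update hn, pathWeight_succ_update hn]
  cases b (initSeg σ N) <;> simp

theorem sum_pathWeight (hn : n ≤ N) :
    ∑ j ∈ Finset.range (2 ^ N), pathWeight b n a N j.testBit =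
      ∑ i ∈ Finset.range (2 ^ n), a.getD i 0 := by
  induction N, hn using Nat.le_induction with
  | base =>
    refine Finset.sum_congr rfl fun i hi => ?_
    rw [pathWeight_self, Nat.ofBits_testBit, Nat.mod_eq_of_lt (Finset.mem_range.1 hi)]
  | succ N hn ih =>
    -- The range up to `2 ^ (N + 1)` splits according to binary digit `N`, which is the last bit of
    -- the string.
    rw [← ih, pow_succ, mul_two, Finset.sum_range_add, ← Finset.sum_add_distrib]
    refine Finset.sum_congr rfl fun j hj => ?_
    have hj := Finset.mem_range.1 hj
    rw [pathWeight_eq_add hn]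
    congr 1 <;> refine pathWeight_congr (hn.trans N.le_succ) fun t ht => ?_
    · rcases (Nat.lt_succ_iff_lt_or_eq.1 ht) with ht | rfl
      · rw [Function.update_of_ne ht.ne]
      · rw [Function.update_self, Nat.testBit_lt_two_pow hj]
    · rcases (Nat.lt_succ_iff_lt_or_eq.1 ht) with ht | rfl
      · rw [Function.update_of_ne ht.ne, Nat.testBit_two_pow_add_gt ht]
      · rw [Function.update_self, Nat.testBit_two_pow_add_eq, Nat.testBit_lt_two_pow hj]
        rfl

theorem initSeg_update_succ (σ : Cantor) (N : ℕ) (s : Bool) :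
    initSeg (Function.update σ N s) (N + 1) = initSeg σ N ++ [s] := by
  rw [initSeg_succ, initSeg_update, Function.update_self]

/-- Masses and path weights are both additive over the two one-bit extensions, so the error at most
doubles with each level descended. -/
theorem abs_mass_sub_pathWeight_le {ν : Source} {D δ : ℝ} (hν : ∀ σ,
    |mass ν (initSeg σ N) - pathWeight b n a N σ / D| ≤ δ) {i m : ℕ} (hi : n ≤ i)
    (him : i + m = N) (σ : Cantor) :
    |mass ν (initSeg σ i) - pathWeight b n a i σ / D| ≤ 2 ^ m * δ := by
  induction m generalizing i σ with
  | zero =>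
    subst him
    simpa using hν σ
  | succ m ih =>
    have h0 := ih (i := i + 1) (by omega) (by omega) (Function.update σ i false)
    have h1 := ih (i := i + 1) (by omega) (by omega) (Function.update σ i true)
    rw [initSeg_update_succ] at h0 h1
    rw [mass_eq_add, pathWeight_eq_add hi]
    push_cast
    have e : ∀ x y z w : ℝ, x + y - (z + w) / D = (x - z / D) + (y - w / D) := fun x y z w => by
      ring
    rw [e]
    refine (abs_add_le _ _).trans ?_
    rw [pow_succ]
    linarith

end PathWeight

/-! ### Small balls on which the forecaster fails. -/

/-- The positions at which the forecasts of `μ` along `σ` are near to those of `ν`. -/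
def agreement (μ ν : Source) (σ : Cantor) : Set ℕ :=
  {t | ∀ s, |condProb μ s (initSeg σ t) - condProb ν s (initSeg σ t)| < 1 / 4}

/-- The code of a small ball around a measure that prolongs the weights `x`, given at level `x.1`,
along the bits prescribed by `b`. -/
def prolongCode (b : List Bool → Bool) (N : ℕ) (x : ℕ × List ℕ) : Code :=
  (2 * x.1 + N,
    (List.range (2 ^ (2 * x.1 + N))).map fun j => pathWeight b x.1 x.2 (2 * x.1 + N) j.testBit,
    1, 2 ^ (2 * x.1 + N + 4) * (x.2.sum * (x.2.sum + 1)))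

theorem sum_prolongCode (b : List Bool → Bool) (N : ℕ) {x : ℕ × List ℕ}
    (hx : x.2.length = 2 ^ x.1) : (prolongCode b N x).2.1.sum = x.2.sum := by
  rw [← sum_range_getD hx, ← sum_pathWeight (b := b) (show x.1 ≤ 2 * x.1 + N by omega)]
  rfl

theorem validCode_prolongCode (b : List Bool → Bool) (N : ℕ) {x : ℕ × List ℕ}
    (hx : x.2.length = 2 ^ x.1) (hx' : 0 < x.2.sum) : ValidCode (prolongCode b N x) := by
  refine ⟨by simp [prolongCode], ?_, one_pos, ?_⟩
  · rwa [sum_prolongCode b N hx]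
  · simp only [prolongCode]
    positivity

theorem computable_prolongCode {b : List Bool → Bool} (hb : Computable b) :
    Computable fun z : ℕ × (ℕ × List ℕ) => prolongCode b z.1 z.2 := by
  have hn : Computable fun z : ℕ × (ℕ × List ℕ) => z.2.1 := Computable.fst.comp Computable.snd
  have ha : Computable fun z : ℕ × (ℕ × List ℕ) => z.2.2 := Computable.snd.comp Computable.snd
  have hM : Computable fun z : ℕ × (ℕ × List ℕ) => 2 * z.2.1 + z.1 :=
    computable_nat_add (computable_nat_mul (Computable.const 2) hn) Computable.fst
  have hs := computable_list_sum ha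
  have hq := computable_nat_mul (computable_two_pow (computable_nat_add hM (Computable.const 4)))
    (computable_nat_mul hs (computable_nat_add hs (Computable.const 1)))
  refine hM.pair (Computable.pair ?_ ((Computable.const 1).pair hq))
  refine computable_map_range (computable_two_pow hM) ?_
  simp only [pathWeight, Nat.ofBits_testBit]
  refine computable_ite (computable_forall_lt (hM.comp Computable.fst) ?_)
    (computable_getD (ha.comp Computable.fst) (computable_nat_mod Computable.snd
      (computable_two_pow (hn.comp Computable.fst)))) (Computable.const 0)
  have hj : Computable fun y : ((ℕ × (ℕ × List ℕ)) × ℕ) × ℕ => y.1.2 :=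
    Computable.snd.comp Computable.fst
  exact computable_or
    (computable_lt Computable.snd (hn.comp (Computable.fst.comp Computable.fst)))
    (computable_eq (computable_testBit hj Computable.snd)
      (hb.comp (computable_initSeg_testBit hj Computable.snd)))

section Prolong

variable {b : List Bool → Bool} {N : ℕ} {x : ℕ × List ℕ} {V : Set Source} {ν : Source}

theorem abs_mass_sub_pathWeight_lt_of_mem (hx : x.2.length = 2 ^ x.1)
    (hV : IsCode (prolongCode b N x) V) (hν : ν ∈ V) (σ : Cantor) :
    |mass ν (initSeg σ (2 * x.1 + N)) - pathWeight b x.1 x.2 (2 * x.1 + N) σ / x.2.sum| <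
      1 / (2 ^ (2 * x.1 + N + 4) * (x.2.sum * (x.2.sum + 1))) := by
  have hs := sum_prolongCode b N hx
  have h := (IsCode.mem_iff hV).1 hν fun i => σ i
  have hw : initSeg σ (2 * x.1 + N) = List.ofFn fun i : Fin (2 * x.1 + N) => σ i := rfl
  have hlt := Nat.ofBits_lt_two_pow fun i : Fin (2 * x.1 + N) => σ i
  have hg : ((List.range (2 ^ (2 * x.1 + N))).map fun j =>
      pathWeight b x.1 x.2 (2 * x.1 + N) j.testBit).getD
        (Nat.ofBits fun i : Fin (2 * x.1 + N) => σ i) 0 =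
      pathWeight b x.1 x.2 (2 * x.1 + N) σ := by
    rw [List.getD_eq_getElem _ _ (by simpa using hlt), List.getElem_map, List.getElem_range]
    exact pathWeight_congr (by omega) fun t ht => Nat.testBit_ofBits_lt _ t ht
  simp only [prolongCode] at hs
  rw [hs, hg, ← hw] at h
  exact_mod_cast h

theorem abs_mass_sub_pathWeight_le_of_mem (hx : x.2.length = 2 ^ x.1)
    (hV : IsCode (prolongCode b N x) V) (hν : ν ∈ V) {i : ℕ} (hi : x.1 ≤ i)
    (hi' : i ≤ 2 * x.1 + N) (σ : Cantor) :
    |mass ν (initSeg σ i) - pathWeight b x.1 x.2 i σ / x.2.sum| ≤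
      1 / (16 * (x.2.sum * (x.2.sum + 1))) := by
  have hD : 0 < x.2.sum := by
    rw [← sum_prolongCode b N hx]
    exact hV.validCode.2.1
  have h := abs_mass_sub_pathWeight_le
    (fun σ => (abs_mass_sub_pathWeight_lt_of_mem hx hV hν σ).le) hi (Nat.add_sub_of_le hi') σ
  refine h.trans ?_
  have hD' : (0 : ℝ) < x.2.sum := by exact_mod_cast hD
  have hle : (2 : ℝ) ^ (2 * x.1 + N - i) ≤ 2 ^ (2 * x.1 + N) :=
    pow_le_pow_right₀ (by norm_num) (Nat.sub_le _ _)
  -- The factor `2 ^ (2 * x.1 + N)` in the radius pays for all doublings; `2 ^ 4` leaves the 16.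
  have e : (1 : ℝ) / (16 * (x.2.sum * (x.2.sum + 1))) =
      2 ^ (2 * x.1 + N) * (1 / (2 ^ (2 * x.1 + N + 4) * (x.2.sum * (x.2.sum + 1)))) := by
    field_simp
    ring
  rw [e]
  exact mul_le_mul_of_nonneg_right hle (by positivity)

/-- The ball's centre has denominator `A = x.2.sum`, while the mixtures have `A + 1`. A positive
weight thus leaves room of at least `1 / (A * (A + 1))`, more than the error in the ball. -/
theorem Admissible.subset_of_isCode_prolongCode {W : Set Source} (hx : Admissible x W)
    (hW : W ∈ basisW) (hV : IsCode (prolongCode b N x) V) : V ⊆ W := by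
  intro ν hν
  refine hx.mem hW fun i hi => ?_
  have h := abs_mass_sub_pathWeight_le_of_mem hx.1 hV hν le_rfl (by omega) i.testBit
  rw [pathWeight_self, Nat.ofBits_testBit, Nat.mod_eq_of_lt hi] at h
  have hD : (0 : ℝ) < x.2.sum := by exact_mod_cast hx.2.1
  rcases Nat.eq_zero_or_pos (x.2.getD i 0) with h0 | h0
  · rw [h0]
    simpa using mass_nonneg _ _
  have h1 : (1 : ℝ) ≤ x.2.getD i 0 := by exact_mod_cast h0
  have h2 := (abs_le.1 h).1
  have e : (x.2.getD i 0 : ℝ) / x.2.sum - x.2.getD i 0 / (x.2.sum + 1) =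
      x.2.getD i 0 / (x.2.sum * (x.2.sum + 1)) := by
    field_simp
    ring
  have h3 : (1 : ℝ) / (16 * (x.2.sum * (x.2.sum + 1))) ≤
      x.2.getD i 0 / (x.2.sum * (x.2.sum + 1)) := by
    have hp : (0 : ℝ) < x.2.sum * (x.2.sum + 1) := by positivity
    exact div_le_div₀ (by linarith) h1 hp (by linarith)
  linarith

theorem notMem_agreement {μ : Source} (hμ : ∀ w, 0 < mass μ w)
    (hb : ∀ w, mass μ (w ++ [b w]) < 5 / 8 * mass μ w) (hx : x.2.length = 2 ^ x.1)
    (hV : IsCode (prolongCode b N x) V) (hν : ν ∈ V) {σ : Cantor}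
    (hσ : pathWeight b x.1 x.2 (2 * x.1 + N) σ ≠ 0) {t : ℕ} (ht : x.1 ≤ t)
    (ht' : t < 2 * x.1 + N) : t ∉ agreement μ ν σ := by
  intro h
  have hD : 0 < x.2.sum := by
    rw [← sum_prolongCode b N hx]
    exact hV.validCode.2.1
  have hD' : (1 : ℝ) ≤ x.2.sum := by exact_mod_cast hD
  set w := initSeg σ t with hw
  have hpath : ∀ t < 2 * x.1 + N, t < x.1 ∨ σ t = b (initSeg σ t) := by
    by_contra hc
    exact hσ (if_neg hc)
  have hwt : 1 ≤ pathWeight b x.1 x.2 t σ := by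
    rw [pathWeight, if_pos hpath] at hσ
    rw [pathWeight, if_pos fun s hs => hpath s (hs.trans ht')]
    exact Nat.one_le_iff_ne_zero.2 hσ
  have h1 := abs_mass_sub_pathWeight_le_of_mem hx hV hν ht ht'.le σ
  -- The extension of `w` by the wrong bit has path weight 0, so its `ν`-mass is pure error.
  have h2 := abs_mass_sub_pathWeight_le_of_mem hx hV hν (ht.trans t.le_succ) ht'
    (Function.update σ t (!b w))
  rw [initSeg_update_succ, pathWeight_succ_update ht, if_neg (by simp [hw]), ← hw, Nat.cast_zero,
    zero_div, sub_zero] at h2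
  have h3 : (1 : ℝ) / (16 * (x.2.sum * (x.2.sum + 1))) ≤ 1 / 16 * (1 / x.2.sum) := by
    rw [one_div_mul_one_div]
    gcongr
    nlinarith
  have h4 : (1 : ℝ) / x.2.sum ≤ pathWeight b x.1 x.2 t σ / x.2.sum := by
    gcongr
    exact_mod_cast hwt
  have h5 := (abs_le.1 h1).1
  have h6 := (abs_le.1 h2).2
  have hpos : (0 : ℝ) < 1 / x.2.sum := by positivity
  have hm : 0 < mass ν w := by linarith
  have hadd : mass ν w = mass ν (w ++ [b w]) + mass ν (w ++ [!b w]) := by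
    rw [mass_eq_add]
    cases b w
    · rfl
    · exact add_comm _ _
  -- With `A = x.2.sum`, `w` has mass at least `15 / (16 * A)` and its wrong extension at most `1 /
  -- (16 * A)`. Then 9/10 - 5/8 > 1/4 contradicts agreement.
  have h7 : 9 / 10 ≤ condProb ν (b w) w := by
    rw [condProb, le_div_iff₀ hm]
    linarith
  have h8 : condProb μ (b w) w < 5 / 8 := by
    rw [condProb, div_lt_iff₀ (hμ w)]
    exact hb w
  have h9 := (abs_lt.1 (h (b w))).1
  linarith

theorem measure_agreement_le {μ : Source} (hμ : ∀ w, 0 < mass μ w)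
    (hb : ∀ w, mass μ (w ++ [b w]) < 5 / 8 * mass μ w) (hx : x.2.length = 2 ^ x.1)
    (hV : IsCode (prolongCode b N x) V) (hν : ν ∈ V) :
    (ν : Measure Cantor) {σ | 2 * x.1 + N < 2 * (agreement μ ν σ ∩ Set.Iio (2 * x.1 + N)).ncard} ≤
      1 / 2 := by
  set M := 2 * x.1 + N with hM
  have hD : 0 < x.2.sum := by
    rw [← sum_prolongCode b N hx]
    exact hV.validCode.2.1
  have hD' : (1 : ℝ) ≤ x.2.sum := by exact_mod_cast hD
  let T : Finset (Fin M → Bool) := {w | pathWeight b x.1 x.2 M (Nat.ofBits w).testBit = 0}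
  have hsub : {σ | M < 2 * (agreement μ ν σ ∩ Set.Iio M).ncard} ⊆ ⋃ w ∈ T, cyl (List.ofFn w) := by
    intro σ hσ
    have h0 : pathWeight b x.1 x.2 M σ = 0 := by
      by_contra hne
      -- On a path of nonzero weight agreement is confined to the first `x.1 ≤ M / 2` positions.
      have h1 : agreement μ ν σ ∩ Set.Iio M ⊆ Set.Iio x.1 := fun t ht => by
        by_contra hc
        exact notMem_agreement hμ hb hx hV hν hne (not_lt.1 hc) ht.2 ht.1
      have h2 := Set.ncard_le_ncard h1 (Set.finite_Iio _)
      rw [← Finset.coe_range x.1, Set.ncard_coe_finset, Finset.card_range] at h2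
      simp only [Set.mem_ofPred_eq] at hσ
      omega
    refine Set.mem_biUnion (x := fun i : Fin M => σ i) ?_ ?_
    · simp only [T, Finset.mem_coe, Finset.mem_filter, Finset.mem_univ, true_and]
      rw [← h0]
      exact pathWeight_congr (by omega) fun t ht => Nat.testBit_ofBits_lt _ t ht
    · rw [cyl_ofFn]
      rfl
  -- At most `2 ^ M` strings have weight 0, each of mass at most `2⁻¹ ^ (M + 4)`.
  have hreal : (ν : Measure Cantor).real (⋃ w ∈ T, cyl (List.ofFn w)) ≤ 1 / 2 := by
    refine (measureReal_biUnion_finset_le T _).trans ?_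
    have hb' : ∀ w ∈ T, (ν : Measure Cantor).real (cyl (List.ofFn w)) ≤ 1 / 2 ^ (M + 4) := by
      intro w hw
      have h0 := (Finset.mem_filter.1 hw).2
      have h1 := abs_mass_sub_pathWeight_lt_of_mem hx hV hν (Nat.ofBits w).testBit
      rw [← hM, h0, Nat.cast_zero, zero_div, sub_zero] at h1
      have h2 : initSeg (Nat.ofBits w).testBit M = List.ofFn w := by
        simp [initSeg, Nat.testBit_ofBits_lt]
      rw [h2] at h1
      refine (le_abs_self _).trans (h1.le.trans ?_)
      gcongr
      exact le_mul_of_one_le_right (by positivity) (by nlinarith)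
    refine (Finset.sum_le_card_nsmul T _ _ hb').trans ?_
    have hcard : (T.card : ℝ) ≤ 2 ^ M := by
      have := T.card_le_univ
      simp only [Fintype.card_fun, Fintype.card_bool, Fintype.card_fin] at this
      exact_mod_cast this
    rw [nsmul_eq_mul, pow_add]
    calc (T.card : ℝ) * (1 / (2 ^ M * 2 ^ 4)) ≤ 2 ^ M * (1 / (2 ^ M * 2 ^ 4)) := by gcongr
      _ ≤ 1 / 2 := by
        field_simp
        norm_num
  refine (measure_mono hsub).trans ?_
  rw [← ENNReal.ofReal_toReal (measure_ne_top (ν : Measure Cantor) (⋃ w ∈ T, cyl (List.ofFn w)))]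
  refine (ENNReal.ofReal_le_ofReal hreal).trans ?_
  rw [ENNReal.ofReal_div_of_pos (by norm_num)]
  simp

end Prolong

/-! ### What weak learning implies about agreement. -/

theorem HasDensityOne.exists_forall_lt_two_mul_ncard {K S : Set ℕ} (hK : HasDensityOne K) {T : ℕ}
    (hKS : ∀ t ∈ K, T ≤ t → t ∈ S) : ∃ N, ∀ M ≥ N, M < 2 * (S ∩ Set.Iio M).ncard := by
  -- Discarding the positions below `T` costs less than `M / 4`, so 3/4 leaves more than 1/2.
  have h := (hK.eventually (lt_mem_nhds (show (3 / 4 : ℝ) < 1 by norm_num))).and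
    (eventually_gt_atTop (4 * T))
  obtain ⟨N, hN⟩ := eventually_atTop.1 h
  refine ⟨N, fun M hM => ?_⟩
  obtain ⟨h1, h2⟩ := hN M hM
  have hM0 : (0 : ℝ) < M := by exact_mod_cast (Nat.zero_le _).trans_lt h2
  rw [lt_div_iff₀ hM0] at h1
  have h3 : (K ∩ Set.Iio M).ncard ≤ (S ∩ Set.Iio M).ncard + T := by
    have hsub : K ∩ Set.Iio M ⊆ (S ∩ Set.Iio M) ∪ Set.Iio T := fun t ht => by
      rcases lt_or_ge t T with h | h
      · exact Or.inr h
      · exact Or.inl ⟨hKS t ht.1 h, ht.2⟩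
    refine (Set.ncard_le_ncard hsub
      (((Set.finite_Iio M).inter_of_right S).union (Set.finite_Iio T))).trans ?_
    refine (Set.ncard_union_le _ _).trans ?_
    rw [← Finset.coe_range T, Set.ncard_coe_finset, Finset.card_range]
  have h3' : ((K ∩ Set.Iio M).ncard : ℝ) ≤ (S ∩ Set.Iio M).ncard + T := by exact_mod_cast h3
  have h2' : (4 * T : ℝ) < M := by exact_mod_cast h2
  have : (M : ℝ) < 2 * (S ∩ Set.Iio M).ncard := by linarith
  exact_mod_cast this

/-- The threshold beyond which agreement prevails depends on the sequence; continuity from below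
along the increasing events `E N` makes it uniform with probability above 1/2. -/
theorem WeaklyNCLearns.exists_lt_measure_agreement {μ ν : Source} (h : WeaklyNCLearns μ ν) :
    ∃ N, ∀ M ≥ N, 1 / 2 <
      (ν : Measure Cantor) {σ | M < 2 * (agreement μ ν σ ∩ Set.Iio M).ncard} := by
  let E : ℕ → Set Cantor := fun N => {σ | ∀ M ≥ N, M < 2 * (agreement μ ν σ ∩ Set.Iio M).ncard}
  have hE : Monotone E := fun N N' hN σ hσ M hM => hσ M (hN.trans hM)
  have hall : ∀ᵐ σ ∂(ν : Measure Cantor), σ ∈ ⋃ N, E N := by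
    filter_upwards [h] with σ hσ
    obtain ⟨K, hK, hlim⟩ := hσ
    have hev : ∀ᶠ t in atTop ⊓ 𝓟 K, t ∈ agreement μ ν σ := by
      refine eventually_all.2 fun s => ?_
      simpa using (hlim s).eventually (Metric.ball_mem_nhds 0 (show (0 : ℝ) < 1 / 4 by norm_num))
    rw [eventually_inf_principal, eventually_atTop] at hev
    obtain ⟨T, hT⟩ := hev
    exact Set.mem_iUnion.2 (hK.exists_forall_lt_two_mul_ncard fun t ht htT => hT t htT ht)
  have hlim := tendsto_measure_iUnion_atTop (μ := (ν : Measure Cantor)) hE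
  have huniv : (ν : Measure Cantor) (⋃ N, E N) = 1 :=
    (measure_congr (eventuallyEq_univ.2 hall)).trans measure_univ
  rw [huniv] at hlim
  obtain ⟨N, hN⟩ := (hlim.eventually (lt_mem_nhds ENNReal.one_half_lt_one)).exists
  refine ⟨N, fun M hM => ?_⟩
  rw [one_div]
  exact hN.trans_le (measure_mono (t := {σ | M < 2 * (agreement μ ν σ ∩ Set.Iio M).ncard})
    fun σ hσ => hσ M hM)

end

end Forecast

/-! ### Assembly of the nowhere dense pieces. -/

open Forecast in
theorem mainTheorem4 (μ : Source) (hμ : Forecast.IsComputableSource μ)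
    (hF : Forecast.IsForecaster μ) : Forecast.EffectivelyMeagre (Forecast.NCw μ) := by
  obtain ⟨b, hb, hbμ⟩ := exists_computable_unlikely_bit hμ hF
  obtain ⟨f, hf, hadm, hext⟩ := exists_computable_admissible
  have hW : ∀ W : basisW, ∃ c, IsCode c W.1 := fun W => exists_isCode W.2
  choose code hcode using hW
  have hV : ∀ N (W : basisW), ∃ V, IsCode (prolongCode b N (f (code W))) V := fun N W =>
    (validCode_prolongCode b N (hadm _ _ (hcode W)).1 (hadm _ _ (hcode W)).2.1).exists_isCode
  choose V hV using hV
  have hg : Computable fun z : ℕ × Code => prolongCode b z.1 (f z.2) := by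
    have hz : Computable fun z : ℕ × Code => (z.1, f z.2) :=
      Computable.fst.pair (hf.comp Computable.snd)
    have h := (computable_prolongCode hb).comp hz
    simp only at h
    exact h
  have hF' : ComputableOnW fun N W => ⟨V N W, (hV N W).mem_basisW⟩ :=
    ⟨fun z => prolongCode b z.1 (f z.2), hg, fun N c W hc => by
      have h := hV N W
      -- The code chosen for `W` is not computed; any given code yields the same weights, hence the
      -- same ball.
      rw [hext _ c _ (hcode W) hc] at h
      exact h⟩
  refine ⟨fun ν hν => hν.1, fun N W => ⟨V N W, (hV N W).mem_basisW⟩,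
    hF',
    fun N => {ν | ν ∈ NCw μ ∧ ∀ M ≥ N, 1 / 2 <
      (ν : Measure Cantor) {σ | M < 2 * (agreement μ ν σ ∩ Set.Iio M).ncard}},
    fun N ν hν => hν.1.1, fun N W => ⟨?_, ?_⟩, ?_⟩
  · exact (hadm _ _ (hcode W)).subset_of_isCode_prolongCode W.2 (hV N W)
  · refine Set.eq_empty_of_forall_notMem fun ν ⟨⟨_, h⟩, hν⟩ => ?_
    -- The level `2 * n + N` of the ball is at least `N`, so both bounds apply there.
    exact (h _ (Nat.le_add_left _ _)).not_ge
      (measure_agreement_le hF.mass_pos hbμ (hadm _ _ (hcode W)).1 (hV N W) hν)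
  · ext ν
    simp only [Set.mem_iUnion]
    exact ⟨fun h => h.2.exists_lt_measure_agreement.imp fun N hN => ⟨h, hN⟩,
      fun ⟨N, h⟩ => h.1⟩
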